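/- Let $n$ be a dimension, and let $E$ be one of the following spaces of test functions $\mathbb R^n\to\mathbb C$: $\mathscr D_a$ ($a>0$), the smooth functions vanishing at all $x$ with $|x|>a$, with the topology of uniform convergence of all derivatives; $\mathscr D=\bigcup_{m\ge1}\mathscr D_m$, with the strict inductive limit (LF) topology; or $\mathscr S$, the Schwartz space of rapidly decreasing smooth functions, with its usual Fréchet topology. Let $\gamma\in C(0)$, that is, $\gamma:\mathbb C\to\mathbb C$ satisfies $\lim_{t\to0}\gamma(t)=\gamma(0)=0$ and $|\gamma(t)|\ge|t|$ whenever $|t|\le1$. Let $U$ be a neighbourhood of $0$ in $E$, and let $Y$ be a complex topological vector space. Let $\mathscr L_{\gamma,U}(E,Y)$ be the set of demi-linear maps, that is, of all $f:E\to Y$ such that $f(0)=0$ and such that for all $x\in E$, $u\in U$ and $t\in\mathbb C$ with $|t|\le1$ there are $r,s\in\mathbb C$ with $|r-1|\le|\gamma(t)|$, $|s|\le|\gamma(t)|$ and $f(x+tu)=r\,f(x)+s\,f(u)$. **Theorem 1.2.** If $f,f_\nu\in\mathscr L_{\gamma,U}(E,Y)$ $(\nu=1,2,3,\dots)$ are continuous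 and $f_\nu(\xi)\to f(\xi)$ for each $\xi\in E$, then for every bounded set $B\subset E$, $f_\nu(\xi)\to f(\xi)$ uniformly for $\xi\in B$; that is, for every neighbourhood $V$ of $0$ in $Y$ there is $\nu_0$ such that $f_\nu(\xi)-f(\xi)\in V$ for all $\nu\ge\nu_0$ and all $\xi\in B$. -/

import Mathlib

open Filter Topology TopologicalSpace

/-- The class `C(0)` of control functions `γ : ℂ → ℂ`: `lim_{t → 0} γ t = γ 0 = 0` and
`|t| ≤ |γ t|` whenever `|t| ≤ 1`. -/
def DemiLinearControl : Set (ℂ → ℂ) :=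
  {γ | γ 0 = 0 ∧ Tendsto γ (𝓝[≠] 0) (𝓝 0) ∧ ∀ t : ℂ, ‖t‖ ≤ 1 → ‖t‖ ≤ ‖γ t‖}

/-- The class `L_{γ,U}(X, Y)` of demi-linear maps: `f 0 = 0`, and for all `x ∈ X`, `u ∈ U` and
scalars `|t| ≤ 1` there are scalars `r, s` with `|r - 1| ≤ |γ t|`, `|s| ≤ |γ t|` and
`f (x + t u) = r f x + s f u`. -/
def DemiLinear {X Y : Type*} [AddCommGroup X] [Module ℂ X] [AddCommGroup Y] [Module ℂ Y]
    (γ : ℂ → ℂ) (U : Set X) : Set (X → Y) :=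
  {f | f 0 = 0 ∧ ∀ x : X, ∀ u ∈ U, ∀ t : ℂ, ‖t‖ ≤ 1 →
    ∃ r s : ℂ, ‖r - 1‖ ≤ ‖γ t‖ ∧ ‖s‖ ≤ ‖γ t‖ ∧ f (x + t • u) = r • f x + s • f u}

/-- The closed Euclidean ball of radius `a` about the origin of `ℝⁿ`, as a compact set. -/
def euclideanClosedBall (n : ℕ) (a : ℝ) : Compacts (EuclideanSpace ℝ (Fin n)) :=
  ⟨Metric.closedBall 0 a, isCompact_closedBall 0 a⟩

/-- The space `D_a` of smooth functions `ℝⁿ → ℂ` that vanish at all `x` with `|x| > a`, with the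
topology of uniform convergence of all derivatives. -/
abbrev TestSpaceDBall (n : ℕ) (a : ℝ) : Type :=
  ContDiffMapSupportedIn (EuclideanSpace ℝ (Fin n)) ℂ (⊤ : ℕ∞) (euclideanClosedBall n a)

/-- The space `D` of smooth compactly supported functions `ℝⁿ → ℂ`, with its `LF` topology. -/
abbrev TestSpaceD (n : ℕ) : Type :=
  TestFunction (⊤ : Opens (EuclideanSpace ℝ (Fin n))) ℂ (⊤ : ℕ∞)

/-- The space `S` of smooth rapidly decreasing functions `ℝⁿ → ℂ`. -/
abbrev TestSpaceS (n : ℕ) : Type :=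
  SchwartzMap (EuclideanSpace ℝ (Fin n)) ℂ

/-- The convergence principle for a class `F` of maps from `E` to `Y`: whenever a sequence of
continuous members of `F` converges at each point of `E` to a continuous member `f` of `F`, it
converges to `f` uniformly on every (von Neumann) bounded subset of `E`. -/
def PointwiseImpliesUniformOnBounded {E Y : Type*}
    [AddCommGroup E] [Module ℂ E] [TopologicalSpace E] [AddCommGroup Y] [TopologicalSpace Y]
    (F : Set (E → Y)) : Prop :=
  ∀ (f : E → Y) (fseq : ℕ → E → Y), f ∈ F → Continuous f →
    (∀ ν, fseq ν ∈ F) → (∀ ν, Continuous (fseq ν)) →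
    (∀ ξ : E, Tendsto (fun ν ↦ fseq ν ξ) atTop (𝓝 (f ξ))) →
    ∀ B : Set E, Bornology.IsVonNBounded ℂ B →
      ∀ V ∈ 𝓝 (0 : Y), ∀ᶠ ν in atTop, ∀ ξ ∈ B, fseq ν ξ - f ξ ∈ V

/-!
The proof rests on two properties of the Schwartz space and of the spaces of functions supported in
a ball: they are Baire spaces, and their bounded sets are relatively compact.

On a Baire space, a pointwise convergent sequence of continuous demi-linear maps is equicontinuous.
It is pointwise bounded, so by Baire's theorem it is bounded, relative to a given neighbourhood of
`0` in `Y`, near some point `x₀` of `U`. The demi-linear identities carry this bound to a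
neighbourhood of `0` (`DemiLinear.exists_nhds_zero_forall_mem`) and then give equicontinuity at each
point (`DemiLinear.exists_nhds_forall_sub_mem`). Equicontinuity and pointwise convergence to a
continuous limit imply uniform convergence on compact sets, hence on bounded sets when these are
relatively compact (`pointwiseImpliesUniformOnBounded_demiLinear`).

The Schwartz space is complete, because uniform limits of all derivatives are the derivatives of the
limit (`SchwartzMap.exists_le_nhds_of_forall_seminorm_sub_le`), and its bounded sets are relatively
compact by an Arzelà–Ascoli argument on large balls combined with uniform decay outside them
(`SchwartzMap.exists_mem_forall_seminorm_sub_le`). Both properties pass to the functions supported in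
a compact set, which form a closed subspace
(`ContDiffMapSupportedIn.isClosedEmbedding_toSchwartzMapLM`).

The space of all test functions need not be a Baire space, but each of its bounded sets lies, and is
bounded, in the space of functions supported in some ball
(`TestFunction.exists_forall_norm_le_of_isVonNBounded` and
`TestFunction.isVonNBounded_preimage_ofSupportedIn`), to which the maps can be restricted.
-/

section Abstract

open scoped Pointwise

/-! ### Equicontinuity of pointwise convergent sequences of demi-linear maps -/

/-- Arbitrarily small values of a control function are attained at nonzero scalars of the unit
disc: `γ` tends to `0` along the punctured neighbourhoods of `0`. -/
theorem DemiLinearControl.exists_small {γ : ℂ → ℂ} (hγ : γ ∈ DemiLinearControl) (a : ℝ) :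
    ∃ t : ℂ, t ≠ 0 ∧ ‖t‖ ≤ 1 ∧ ‖γ t‖ ≤ 1 ∧ ‖γ t‖ * a ≤ 1 := by
  have h0 : Tendsto (fun t ↦ ‖γ t‖) (𝓝[≠] 0) (𝓝 0) := by simpa using hγ.2.1.norm
  have h1 : ∀ᶠ t in 𝓝[≠] (0 : ℂ), ‖γ t‖ < 1 := h0.eventually_lt_const one_pos
  have h2 : ∀ᶠ t in 𝓝[≠] (0 : ℂ), ‖γ t‖ * a < 1 := by
    have : Tendsto (fun t ↦ ‖γ t‖ * a) (𝓝[≠] 0) (𝓝 0) := by simpa using h0.mul_const a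
    exact this.eventually_lt_const one_pos
  have h3 : ∀ᶠ t in 𝓝[≠] (0 : ℂ), ‖t‖ < 1 :=
    eventually_nhdsWithin_of_eventually_nhds
      ((continuous_norm.tendsto' (0 : ℂ) 0 norm_zero).eventually_lt_const one_pos)
  obtain ⟨t, ⟨⟨h1, h2⟩, h3⟩, h4⟩ :=
    ((h1.and h2).and h3 |>.and eventually_mem_nhdsWithin).exists
  exact ⟨t, h4, h3.le, h1.le, h2.le⟩

theorem Balanced.smul_mem_of_mem_smul {Y : Type*} [AddCommGroup Y] [Module ℂ Y] {V : Set Y}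
    (hV : Balanced ℂ V) {c a : ℂ} {y : Y}
    (hy : y ∈ a • V) (hc : ‖c‖ * ‖a‖ ≤ 1) : c • y ∈ V := by
  obtain ⟨v, hv, rfl⟩ := hy
  rw [smul_smul]
  exact hV.smul_mem (by rwa [norm_mul]) hv

variable {E Y : Type*} [AddCommGroup E] [Module ℂ E] [TopologicalSpace E]
  [AddCommGroup Y] [Module ℂ Y] [TopologicalSpace Y]

/-- A convergent sequence is absorbed by each neighbourhood of `0`. -/
theorem Filter.Tendsto.exists_forall_mem_smul [IsTopologicalAddGroup Y] [ContinuousSMul ℂ Y]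
    {y : ℕ → Y} {z : Y} (h : Tendsto y atTop (𝓝 z)) {V : Set Y} (hV : V ∈ 𝓝 0) :
    ∃ m : ℕ, ∀ ν, y ν ∈ ((m : ℂ) + 1) • V := by
  let _ := IsTopologicalAddGroup.rightUniformSpace Y
  have := isUniformAddGroup_of_addCommGroup (G := Y)
  have hb : Bornology.IsVonNBounded ℂ (Set.range y) := h.isVonNBounded_range ℂ
  obtain ⟨r, -, hr⟩ := (hb hV).exists_pos
  obtain ⟨m, hm⟩ := exists_nat_ge r
  refine ⟨m, fun ν ↦ hr _ ?_ ⟨ν, rfl⟩⟩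
  have : ‖(m : ℂ) + 1‖ = m + 1 := by exact_mod_cast Complex.norm_natCast (m + 1)
  linarith

theorem exists_balanced_closed_add_subset [IsTopologicalAddGroup Y] [ContinuousSMul ℂ Y]
    {V : Set Y} (hV : V ∈ 𝓝 0) :
    ∃ V₁ ∈ 𝓝 (0 : Y), Balanced ℂ V₁ ∧ IsClosed V₁ ∧ ∀ a ∈ V₁, ∀ b ∈ V₁, a + b ∈ V := by
  obtain ⟨V₀, hV₀, hadd⟩ := exists_nhds_zero_half hV
  obtain ⟨V₁, ⟨h1, h2, h3⟩, h4⟩ := (nhds_basis_closed_balanced ℂ Y).mem_iff.1 hV₀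
  exact ⟨V₁, h1, h3, h2, fun a ha b hb ↦ hadd a (h4 ha) b (h4 hb)⟩

variable [IsTopologicalAddGroup E] [ContinuousSMul ℂ E]
  [IsTopologicalAddGroup Y] [ContinuousSMul ℂ Y] {γ : ℂ → ℂ} {U : Set E}
  {f : ℕ → E → Y}

/-- Equicontinuity at `0` of a pointwise bounded sequence of continuous demi-linear maps on a Baire
space. Baire's theorem gives a bound on a neighbourhood of some `x₀`; demi-linearity in the
direction `x₀` with `t = -1` moves the bound to a neighbourhood of `0`, and small `t` shrink it.
Choosing `x₀ ∈ U` lets a single step suffice, so that the number of summands, hence the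
neighbourhood `V₁` with `V₁ + V₁ ⊆ V`, is fixed beforehand although `Y` need not be
locally convex. -/
theorem DemiLinear.exists_nhds_zero_forall_mem [BaireSpace E] (hγ : γ ∈ DemiLinearControl)
    (hU : U ∈ 𝓝 0) (hf : ∀ ν, f ν ∈ DemiLinear γ U) (hc : ∀ ν, Continuous (f ν))
    (hb : ∀ V ∈ 𝓝 (0 : Y), ∀ x, ∃ m : ℕ, ∀ ν, f ν x ∈ ((m : ℂ) + 1) • V)
    {V : Set Y} (hV : V ∈ 𝓝 0) : ∃ W ∈ 𝓝 (0 : E), ∀ ν, ∀ w ∈ W, f ν w ∈ V := by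
  obtain ⟨V₁, hV₁, hbal, hcl, hadd⟩ := exists_balanced_closed_add_subset hV
  let A : ℕ → Set E := fun m ↦ {x | ∀ ν, f ν x ∈ ((m : ℂ) + 1) • V₁}
  have hA : ∀ m, IsClosed (A m) := fun m ↦ by
    simp only [A, Set.ofPred_forall]
    exact isClosed_iInter fun ν ↦
      (hcl.smul_of_ne_zero (Nat.cast_add_one_ne_zero m)).preimage (hc ν)
  have hcover : ⋃ m, A m = Set.univ :=
    Set.eq_univ_of_forall fun x ↦ Set.mem_iUnion.2 (hb V₁ hV₁ x)
  obtain ⟨x₀, hx₀U, hx₀⟩ := (dense_iUnion_interior_of_closed hA hcover).inter_open_nonempty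
    (interior U) isOpen_interior ⟨0, mem_interior_iff_mem_nhds.2 hU⟩
  obtain ⟨m, hm⟩ := Set.mem_iUnion.1 hx₀
  have hmn : ‖(m : ℂ) + 1‖ = m + 1 := by exact_mod_cast Complex.norm_natCast (m + 1)
  obtain ⟨t, ht0, ht1, -, ht⟩ := DemiLinearControl.exists_small hγ ((1 + ‖γ (-1)‖) * (m + 1))
  have hN : {w | w ∈ U ∧ x₀ + w ∈ A m} ∈ 𝓝 (0 : E) := by
    refine inter_mem hU ?_
    have : Tendsto (fun w ↦ x₀ + w) (𝓝 0) (𝓝 x₀) :=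
      (continuous_const.add continuous_id).tendsto' _ _ (add_zero x₀)
    exact this (mem_interior_iff_mem_nhds.1 hm)
  refine ⟨t • {w | w ∈ U ∧ x₀ + w ∈ A m}, (set_smul_mem_nhds_zero_iff ht0).2 hN, ?_⟩
  rintro ν _ ⟨w, ⟨hwU, hwA⟩, rfl⟩
  -- `w = (x₀ + w) + (-1) x₀`, and `x₀ ∈ U` is an admissible direction.
  obtain ⟨r, s, hr, hs, h⟩ := (hf ν).2 (x₀ + w) x₀ (interior_subset hx₀U) (-1) (by simp)
  obtain ⟨r', s', -, hs', h'⟩ := (hf ν).2 0 w hwU t ht1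
  have hw : x₀ + w + (-1 : ℂ) • x₀ = w := by simp
  rw [zero_add, (hf ν).1, smul_zero, zero_add] at h'
  rw [hw] at h
  have hr1 : ‖r‖ ≤ 1 + ‖γ (-1)‖ := by
    calc ‖r‖ = ‖1 + (r - 1)‖ := by ring_nf
      _ ≤ 1 + ‖γ (-1)‖ := (norm_add_le _ _).trans (by simpa using hr)
  have hs1 : ‖s‖ ≤ 1 + ‖γ (-1)‖ := hs.trans (by linarith)
  have key : ∀ c : ℂ, ‖c‖ ≤ 1 + ‖γ (-1)‖ → ‖s' * c‖ * ‖(m : ℂ) + 1‖ ≤ 1 := fun c hc ↦ by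
    rw [norm_mul, hmn, mul_assoc]
    exact (mul_le_mul hs' (mul_le_mul_of_nonneg_right hc (by positivity)) (by positivity)
      (norm_nonneg _)).trans ht
  change f ν (t • w) ∈ V
  rw [h', h, smul_add, smul_smul, smul_smul]
  exact hadd _ (hbal.smul_mem_of_mem_smul (hwA ν) (key r hr1))
    _ (hbal.smul_mem_of_mem_smul (interior_subset hm ν) (key s hs1))

/-- Equicontinuity at an arbitrary point `x`, from equicontinuity at `0` and
`f (x + t u) - f x = (r - 1) f x + s f u`. -/
theorem DemiLinear.exists_nhds_forall_sub_mem [BaireSpace E] (hγ : γ ∈ DemiLinearControl)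
    (hU : U ∈ 𝓝 0) (hf : ∀ ν, f ν ∈ DemiLinear γ U) (hc : ∀ ν, Continuous (f ν))
    (hb : ∀ V ∈ 𝓝 (0 : Y), ∀ x, ∃ m : ℕ, ∀ ν, f ν x ∈ ((m : ℂ) + 1) • V)
    (x : E) {V : Set Y} (hV : V ∈ 𝓝 0) : ∃ N ∈ 𝓝 x, ∀ ν, ∀ y ∈ N, f ν y - f ν x ∈ V := by
  obtain ⟨V₁, hV₁, hbal, -, hadd⟩ := exists_balanced_closed_add_subset hV
  obtain ⟨W, hW, hWf⟩ := DemiLinear.exists_nhds_zero_forall_mem hγ hU hf hc hb hV₁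
  obtain ⟨m, hm⟩ := hb V₁ hV₁ x
  have hmn : ‖(m : ℂ) + 1‖ = m + 1 := by exact_mod_cast Complex.norm_natCast (m + 1)
  obtain ⟨t, ht0, ht1, hγ1, ht⟩ := DemiLinearControl.exists_small hγ (m + 1)
  have hN : t • (W ∩ U) ∈ 𝓝 (0 : E) := (set_smul_mem_nhds_zero_iff ht0).2 (inter_mem hW hU)
  have hsub : Tendsto (fun y ↦ y - x) (𝓝 x) (𝓝 0) :=
    (continuous_id.sub continuous_const).tendsto' _ _ (sub_self x)
  refine ⟨_, hsub hN, ?_⟩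
  rintro ν y ⟨u, ⟨huW, huU⟩, hu⟩
  obtain ⟨r, s, hr, hs, h⟩ := (hf ν).2 x u huU t ht1
  have hy : y = x + t • u := by
    have : t • u = y - x := hu
    rw [this, add_sub_cancel]
  have : f ν y - f ν x = (r - 1) • f ν x + s • f ν u := by
    rw [hy, h, sub_smul, one_smul]; abel
  rw [this]
  refine hadd _ (hbal.smul_mem_of_mem_smul (hm ν) ?_) _ (hbal.smul_mem (hs.trans hγ1) (hWf ν u huW))
  rw [hmn]
  exact (mul_le_mul_of_nonneg_right hr (by positivity)).trans ht

/-- The convergence principle on a Baire space whose bounded sets are relatively compact: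
equicontinuity and pointwise convergence give uniform convergence on compact sets. -/
theorem pointwiseImpliesUniformOnBounded_demiLinear [BaireSpace E]
    (hE : ∀ B : Set E, Bornology.IsVonNBounded ℂ B → ∃ K, IsCompact K ∧ B ⊆ K)
    (hγ : γ ∈ DemiLinearControl) (hU : U ∈ 𝓝 0) :
    PointwiseImpliesUniformOnBounded (DemiLinear γ U : Set (E → Y)) := by
  intro f fseq _ hf hseq hc hlim B hB V hV
  obtain ⟨K, hK, hBK⟩ := hE B hB
  have hb : ∀ V ∈ 𝓝 (0 : Y), ∀ x, ∃ m : ℕ, ∀ ν, fseq ν x ∈ ((m : ℂ) + 1) • V :=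
    fun V hV x ↦ (hlim x).exists_forall_mem_smul hV
  obtain ⟨V₁, hV₁, -, -, hadd₁⟩ := exists_balanced_closed_add_subset hV
  obtain ⟨V₂, hV₂, hbal, -, hadd₂⟩ := exists_balanced_closed_add_subset hV₁
  suffices h : ∀ᶠ ν in atTop, ∀ ξ ∈ K, fseq ν ξ - f ξ ∈ V from
    h.mono fun ν hν ξ hξ ↦ hν ξ (hBK hξ)
  refine hK.induction_on (p := fun s ↦ ∀ᶠ ν in atTop, ∀ ξ ∈ s, fseq ν ξ - f ξ ∈ V)
    (by simp) (fun s t hst ht ↦ ht.mono fun ν hν ξ hξ ↦ hν ξ (hst hξ)) ?_ ?_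
  · intro s t hs ht
    filter_upwards [hs, ht] with ν h1 h2 ξ hξ
    exact hξ.elim (h1 ξ) (h2 ξ)
  · intro x _
    obtain ⟨N, hN, hNf⟩ := DemiLinear.exists_nhds_forall_sub_mem hγ hU hseq hc hb x hV₂
    have hM : {y | f x - f y ∈ V₂} ∈ 𝓝 x :=
      ((continuous_const.sub hf).tendsto' x 0 (sub_self (f x))) hV₂
    refine ⟨N ∩ {y | f x - f y ∈ V₂}, mem_nhdsWithin_of_mem_nhds (inter_mem hN hM), ?_⟩
    have hx : Tendsto (fun ν ↦ fseq ν x - f x) atTop (𝓝 0) := by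
      simpa using (hlim x).sub_const (f x)
    have hV₂₁ : V₂ ⊆ V₁ := fun a ha ↦ by
      simpa using hadd₂ a ha 0 (mem_of_mem_nhds hV₂)
    filter_upwards [hx hV₂] with ν hν y hy
    have : fseq ν y - f y = (fseq ν y - fseq ν x + (fseq ν x - f x)) + (f x - f y) := by abel
    rw [this]
    exact hadd₁ _ (hadd₂ _ (hNf ν y hy.1) _ hν) _ (hV₂₁ hy.2)

end Abstract

/-! ### The Schwartz space is a Fréchet–Montel space -/

open scoped ContDiff in
instance {E F : Type*} [NormedAddCommGroup E] [NormedSpace ℝ E]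
    [NormedAddCommGroup F] [NormedSpace ℝ F] [FiniteDimensional ℝ E] [FiniteDimensional ℝ F]
    (m : ℕ) :
    FiniteDimensional ℝ (E [×m]→L[ℝ] F) :=
  .of_injective (V₂ := MultilinearMap ℝ (fun _ : Fin m ↦ E) F)
    { toFun := ContinuousMultilinearMap.toMultilinearMap
      map_add' := fun _ _ ↦ rfl
      map_smul' := fun _ _ ↦ rfl }
    ContinuousMultilinearMap.toMultilinearMap_injective

namespace SchwartzMap
open scoped SchwartzMap ContDiff

variable {E F : Type*} [NormedAddCommGroup E] [NormedSpace ℝ E]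
  [NormedAddCommGroup F] [NormedSpace ℝ F]

theorem iteratedFDeriv_sub_eq (f g : 𝓢(E, F)) (m : ℕ) (x : E) :
    iteratedFDeriv ℝ m (f - g : 𝓢(E, F)) x = iteratedFDeriv ℝ m f x - iteratedFDeriv ℝ m g x := by
  rw [FunLike.coe_sub]
  exact iteratedFDeriv_sub_apply (f.smooth m).contDiffAt (g.smooth m).contDiffAt

/-- A seminorm bound on the derivatives of order `m + 1` makes those of order `m` Lipschitz. -/
theorem norm_iteratedFDeriv_sub_le (f : 𝓢(E, F)) (m : ℕ) (x y : E) :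
    ‖iteratedFDeriv ℝ m f x - iteratedFDeriv ℝ m f y‖ ≤
      SchwartzMap.seminorm ℝ 0 (m + 1) f * ‖x - y‖ := by
  refine Convex.norm_image_sub_le_of_norm_fderiv_le (𝕜 := ℝ) (s := Set.univ) (fun z _ ↦ ?_)
    (fun z _ ↦ ?_) convex_univ (Set.mem_univ y) (Set.mem_univ x)
  · exact (f.smooth (m + 1)).differentiable_iteratedFDeriv (by exact_mod_cast Nat.lt_succ_self m) z
  · rw [norm_fderiv_iteratedFDeriv]
    exact norm_iteratedFDeriv_le_seminorm ℝ f _ z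

/-- If all weighted derivatives converge uniformly, with `g m` the limit of the derivatives of order
`m`, then the `g m` are the derivatives of one Schwartz function. -/
theorem exists_iteratedFDeriv_eq_of_tendsto {l : Filter 𝓢(E, F)} [l.NeBot]
    {g : (m : ℕ) → E → E [×m]→L[ℝ] F}
    (h : ∀ k m : ℕ, ∀ ε > 0, ∀ᶠ f : 𝓢(E, F) in l,
      ∀ x, ‖x‖ ^ k * ‖iteratedFDeriv ℝ m f x - g m x‖ ≤ ε) :
    ∃ f : 𝓢(E, F), ∀ m x, iteratedFDeriv ℝ m f x = g m x := by
  have hunif : ∀ m, TendstoUniformly (fun (f : 𝓢(E, F)) x ↦ iteratedFDeriv ℝ m f x) (g m) l := by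
    intro m
    rw [Metric.tendstoUniformly_iff]
    intro ε hε
    filter_upwards [h 0 m (ε / 2) (half_pos hε)] with f hf x
    rw [dist_comm, dist_eq_norm]
    exact (by simpa using hf x : _ ≤ ε / 2).trans_lt (half_lt_self hε)
  have hderiv : ∀ m x, HasFDerivAt (g m) (g (m + 1) x).curryLeft x := by
    intro m x
    let L := continuousMultilinearCurryLeftEquiv ℝ (fun _ : Fin (m + 1) ↦ E) F
    refine hasFDerivAt_of_tendstoUniformly (l := l)
      (f := fun (f : 𝓢(E, F)) x ↦ iteratedFDeriv ℝ m f x)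
      (f' := fun (f : 𝓢(E, F)) x ↦ (iteratedFDeriv ℝ (m + 1) f x).curryLeft)
      (g' := fun x ↦ (g (m + 1) x).curryLeft) ?_ ?_ (fun x ↦ (hunif m).tendsto_at x) x
    · exact L.isometry.uniformContinuous.comp_tendstoUniformly (hunif (m + 1))
    · intro f x
      exact (contDiff_iff_ftaylorSeries.1 (f.smooth ⊤)).fderiv m
        (by exact_mod_cast WithTop.coe_lt_top m) x
  let f₀ : E → F := fun x ↦ (g 0 x).curry0
  have htaylor : HasFTaylorSeriesUpTo ∞ f₀ (fun x m ↦ g m x) :=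
    (hasFTaylorSeriesUpTo_top_iff' le_rfl).2 ⟨fun _ ↦ rfl, hderiv⟩
  have heq : ∀ m x, iteratedFDeriv ℝ m f₀ x = g m x := fun m x ↦
    (htaylor.eq_iteratedFDeriv (by exact_mod_cast le_top) x).symm
  refine ⟨⟨f₀, htaylor.contDiff, fun k m ↦ ?_⟩, heq⟩
  obtain ⟨f, hf⟩ := (h k m 1 one_pos).exists
  refine ⟨SchwartzMap.seminorm ℝ k m f + 1, fun x ↦ ?_⟩
  rw [heq]
  calc ‖x‖ ^ k * ‖g m x‖
      ≤ ‖x‖ ^ k * (‖iteratedFDeriv ℝ m f x‖ + ‖iteratedFDeriv ℝ m f x - g m x‖) := by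
        gcongr
        rw [add_comm]
        exact norm_le_norm_sub_add _ _ |>.trans (by rw [norm_sub_rev])
    _ ≤ _ := by
        rw [mul_add]
        exact add_le_add (le_seminorm ℝ k m f x) (hf x)

/-- Completeness of the Schwartz space, with the Cauchy condition stated in the seminorms. -/
theorem exists_le_nhds_of_forall_seminorm_sub_le [CompleteSpace F] {l : Filter 𝓢(E, F)} [l.NeBot]
    (h : ∀ k m : ℕ, ∀ ε > 0, ∃ s ∈ l, ∀ f ∈ s, ∀ f' ∈ s,
      SchwartzMap.seminorm ℝ k m (f - f') ≤ ε) :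
    ∃ f, l ≤ 𝓝 f := by
  have hc : ∀ m x, ∃ y, Tendsto (fun f : 𝓢(E, F) ↦ iteratedFDeriv ℝ m f x) l (𝓝 y) := by
    intro m x
    refine CompleteSpace.complete (Metric.cauchy_iff.2 ⟨inferInstance, fun ε hε ↦ ?_⟩)
    obtain ⟨s, hs, hsε⟩ := h 0 m (ε / 2) (half_pos hε)
    refine ⟨_, image_mem_map hs, ?_⟩
    rintro _ ⟨f, hf, rfl⟩ _ ⟨f', hf', rfl⟩
    rw [dist_eq_norm, ← iteratedFDeriv_sub_eq]
    exact ((norm_iteratedFDeriv_le_seminorm ℝ _ _ _).trans (hsε f hf f' hf')).trans_lt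
      (half_lt_self hε)
  choose g hg using hc
  have hlim : ∀ k m : ℕ, ∀ ε > 0, ∀ᶠ f : 𝓢(E, F) in l,
      ∀ x, ‖x‖ ^ k * ‖iteratedFDeriv ℝ m f x - g m x‖ ≤ ε := by
    intro k m ε hε
    obtain ⟨s, hs, hsε⟩ := h k m ε hε
    filter_upwards [hs] with f hf x
    refine le_of_tendsto (((hg m x).const_sub _).norm.const_mul (‖x‖ ^ k)) ?_
    filter_upwards [hs] with f' hf'
    rw [← iteratedFDeriv_sub_eq]
    exact (le_seminorm ℝ k m _ x).trans (hsε f hf f' hf')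
  obtain ⟨f₀, hf₀⟩ := exists_iteratedFDeriv_eq_of_tendsto hlim
  refine ⟨f₀, ?_⟩
  rw [← tendsto_id', (schwartz_withSeminorms ℝ E F).tendsto_nhds]
  rintro ⟨k, m⟩ ε hε
  filter_upwards [hlim k m (ε / 2) (half_pos hε)] with f hf
  refine (seminorm_le_bound ℝ k m _ (half_pos hε).le fun x ↦ ?_).trans_lt (half_lt_self hε)
  rw [id, iteratedFDeriv_sub_eq, hf₀]
  exact hf x

instance [CompleteSpace F] : CompleteSpace 𝓢(E, F) := by
  refine ⟨fun {l} hl ↦ ?_⟩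
  have := hl.1
  refine exists_le_nhds_of_forall_seminorm_sub_le fun k m ε hε ↦ ?_
  have hV : {f : 𝓢(E, F) | SchwartzMap.seminorm ℝ k m f < ε} ∈ 𝓝 0 := by
    have := ((schwartz_withSeminorms ℝ E F).continuous_seminorm (k, m)).tendsto' 0 0 (map_zero _)
    exact this.eventually_lt_const hε
  have hU := preimage_mem_comap (m := fun p : 𝓢(E, F) × 𝓢(E, F) ↦ p.2 - p.1) hV
  rw [← uniformity_eq_comap_nhds_zero] at hU
  obtain ⟨s, hs, hsV⟩ := (cauchy_iff.1 hl).2 _ hU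
  exact ⟨s, hs, fun f hf f' hf' ↦ (hsV (Set.mk_mem_prod hf' hf)).le⟩

instance [CompleteSpace F] : IsCompletelyPseudoMetrizableSpace 𝓢(E, F) := by
  have : (uniformity 𝓢(E, F)).IsCountablyGenerated :=
    IsUniformAddGroup.uniformity_countably_generated
  infer_instance

/-- An ultrafilter containing a bounded set satisfies the Cauchy condition in each seminorm. Outside
a large ball the seminorm of weight `k + 1` makes the weighted derivatives uniformly small; on the
ball the derivatives are equi-Lipschitz, and they converge along the ultrafilter at each of
finitely many points. -/
theorem exists_mem_forall_seminorm_sub_le [FiniteDimensional ℝ E] [FiniteDimensional ℝ F]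
    (u : Ultrafilter 𝓢(E, F)) {B : Set 𝓢(E, F)} (hBu : B ∈ u)
    (hB : Bornology.IsVonNBounded ℝ B) (k m : ℕ) {ε : ℝ} (hε : 0 < ε) :
    ∃ s ∈ u, ∀ f ∈ s, ∀ f' ∈ s, SchwartzMap.seminorm ℝ k m (f - f') ≤ ε := by
  have : ProperSpace E := FiniteDimensional.proper ℝ E
  have : ProperSpace (E [×m]→L[ℝ] F) := FiniteDimensional.proper ℝ _
  have hbd := (schwartz_withSeminorms ℝ E F).isVonNBounded_iff_seminorm_bounded.1 hB
  obtain ⟨C, hC0, hC⟩ := hbd (k + 1, m)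
  obtain ⟨C₁, hC₁0, hC₁⟩ := hbd (0, m + 1)
  obtain ⟨C₂, hC₂0, hC₂⟩ := hbd (0, m)
  simp only [schwartzSeminormFamily_apply] at hC hC₁ hC₂
  -- Outside the ball of radius `R` the bound `2 * C` on the weight `k + 1` gives `ε` on weight `k`.
  set R := 2 * C / ε with hR
  have hR0 : 0 < R := by positivity
  -- On that ball the error is at most `R ^ k` times `δ + 2 * C₁ * δ`.
  set δ := ε / (R ^ k * (2 * C₁ + 1)) with hδ
  have hδ0 : 0 < δ := by positivity
  have hpt : ∀ x : E, ∃ s ∈ u, ∀ f ∈ s, ∀ f' ∈ s,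
      ‖iteratedFDeriv ℝ m f x - iteratedFDeriv ℝ m f' x‖ ≤ δ := by
    intro x
    obtain ⟨y, -, hy⟩ := (isCompact_closedBall (0 : E [×m]→L[ℝ] F) C₂).ultrafilter_le_nhds
      (u.map fun f : 𝓢(E, F) ↦ iteratedFDeriv ℝ m f x) (by
        refine le_principal_iff.2 (mem_map.2 (mem_of_superset hBu fun f hf ↦ ?_))
        simpa using (norm_iteratedFDeriv_le_seminorm ℝ f m x).trans (hC₂ f hf).le)
    refine ⟨_, hy (Metric.closedBall_mem_nhds y (half_pos hδ0)), fun f hf f' hf' ↦ ?_⟩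
    rw [← dist_eq_norm]
    have h1 : dist (iteratedFDeriv ℝ m f x) y ≤ δ / 2 := hf
    have h2 : dist (iteratedFDeriv ℝ m f' x) y ≤ δ / 2 := hf'
    linarith [dist_triangle_right (iteratedFDeriv ℝ m f x) (iteratedFDeriv ℝ m f' x) y]
  choose s hsu hs using hpt
  obtain ⟨t, -, htf, ht⟩ := (isCompact_closedBall (0 : E) R).finite_cover_balls hδ0
  refine ⟨B ∩ ⋂ x ∈ t, s x, inter_mem hBu ((biInter_mem htf).2 fun x _ ↦ hsu x), ?_⟩
  rintro f ⟨hfB, hfs⟩ f' ⟨hfB', hfs'⟩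
  refine seminorm_le_bound ℝ k m _ hε.le fun x ↦ ?_
  rcases le_or_gt ‖x‖ R with hx | hx
  · obtain ⟨z, hzt, hz⟩ := Set.mem_iUnion₂.1 (ht (mem_closedBall_zero_iff.2 hx))
    have hxz : ‖x - z‖ ≤ δ := by rw [← dist_eq_norm]; exact (Metric.mem_ball.1 hz).le
    have h1 : ∀ φ ∈ B, ‖iteratedFDeriv ℝ m φ x - iteratedFDeriv ℝ m φ z‖ ≤ C₁ * δ := fun φ hφ ↦
      (norm_iteratedFDeriv_sub_le φ m x z).trans
        (mul_le_mul (hC₁ φ hφ).le hxz (norm_nonneg _) hC₁0.le)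
    have h2 := hs z f (Set.mem_iInter₂.1 hfs z hzt) f' (Set.mem_iInter₂.1 hfs' z hzt)
    have h3 : ‖iteratedFDeriv ℝ m (f - f' : 𝓢(E, F)) x‖ ≤ δ * (2 * C₁ + 1) := by
      rw [iteratedFDeriv_sub_eq]
      have := norm_add₃_le (a := iteratedFDeriv ℝ m f x - iteratedFDeriv ℝ m f z)
        (b := iteratedFDeriv ℝ m f z - iteratedFDeriv ℝ m f' z)
        (c := -(iteratedFDeriv ℝ m f' x - iteratedFDeriv ℝ m f' z))
      rw [norm_neg] at this
      have h4 := h1 f hfB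
      have h5 := h1 f' hfB'
      refine le_trans (le_of_eq ?_) (this.trans (by linarith))
      congr 1; abel
    calc ‖x‖ ^ k * ‖iteratedFDeriv ℝ m (f - f' : 𝓢(E, F)) x‖
        ≤ R ^ k * (δ * (2 * C₁ + 1)) := by gcongr
      _ = ε := by rw [hδ]; field_simp
  · have h1 := le_seminorm ℝ (k + 1) m (f - f') x
    have h2 : SchwartzMap.seminorm ℝ (k + 1) m (f - f') ≤ C + C :=
      (map_sub_le_add _ f f').trans (add_le_add (hC f hfB).le (hC f' hfB').le)
    have h3 : ε * R = C + C := by rw [hR]; field_simp; ring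
    refine le_of_mul_le_mul_right ?_ hR0
    calc ‖x‖ ^ k * ‖iteratedFDeriv ℝ m (f - f' : 𝓢(E, F)) x‖ * R
        ≤ ‖x‖ ^ k * ‖iteratedFDeriv ℝ m (f - f' : 𝓢(E, F)) x‖ * ‖x‖ := by gcongr
      _ = ‖x‖ ^ (k + 1) * ‖iteratedFDeriv ℝ m (f - f' : 𝓢(E, F)) x‖ := by ring
      _ ≤ ε * R := by linarith

theorem isCompact_of_isClosed_of_isVonNBounded [FiniteDimensional ℝ E] [FiniteDimensional ℝ F]
    {B : Set 𝓢(E, F)} (hcl : IsClosed B) (hB : Bornology.IsVonNBounded ℝ B) : IsCompact B := by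
  have : CompleteSpace F := FiniteDimensional.complete ℝ F
  refine isCompact_iff_ultrafilter_le_nhds.2 fun u hu ↦ ?_
  have hBu : B ∈ u := le_principal_iff.1 hu
  obtain ⟨f, hf⟩ := exists_le_nhds_of_forall_seminorm_sub_le (l := (u : Filter 𝓢(E, F)))
    fun k m ε hε ↦ exists_mem_forall_seminorm_sub_le u hBu hB k m hε
  exact ⟨f, hcl.mem_of_tendsto (b := (u : Filter 𝓢(E, F))) (f := id) hf hBu, hf⟩

instance {𝕜 : Type*} [RCLike 𝕜] [NormedSpace 𝕜 F] [SMulCommClass ℝ 𝕜 F]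
    [FiniteDimensional ℝ E] [FiniteDimensional ℝ F] : MontelSpace 𝕜 𝓢(E, F) where
  heine_borel s hs hb := by
    refine isCompact_of_isClosed_of_isVonNBounded hs ?_
    rw [(schwartz_withSeminorms ℝ E F).isVonNBounded_iff_seminorm_bounded]
    exact (schwartz_withSeminorms 𝕜 E F).isVonNBounded_iff_seminorm_bounded.1 hb

end SchwartzMap

theorem MontelSpace.exists_isCompact_superset {E : Type*} [AddCommGroup E] [Module ℂ E]
    [TopologicalSpace E] [IsTopologicalAddGroup E] [ContinuousSMul ℂ E] [T1Space E]
    [MontelSpace ℂ E]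
    {B : Set E} (hB : Bornology.IsVonNBounded ℂ B) : ∃ K, IsCompact K ∧ B ⊆ K :=
  ⟨closure B, isCompact_of_isClosed_of_isVonNBounded ℂ isClosed_closure hB.closure,
    subset_closure⟩

/-! ### Smooth functions supported in a compact set -/

namespace ContDiffMapSupportedIn
open scoped SchwartzMap ContDiff Distributions

variable {E F : Type*} [NormedAddCommGroup E] [NormedSpace ℝ E]
  [NormedAddCommGroup F] [NormedSpace ℝ F] {K : Compacts E}

/-- The inclusion of the smooth functions supported in the compact set `K` into the Schwartz space,
as a `𝕜`-linear map. -/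
noncomputable def toSchwartzMapLM (𝕜 : Type*) [NontriviallyNormedField 𝕜] [NormedSpace 𝕜 F]
    [SMulCommClass ℝ 𝕜 F] : 𝓓_{K}(E, F) →ₗ[𝕜] 𝓢(E, F) where
  toFun f := f.hasCompactSupport.toSchwartzMap f.contDiff
  map_add' _ _ := rfl
  map_smul' _ _ := rfl

variable (𝕜 : Type*) [NontriviallyNormedField 𝕜] [NormedSpace 𝕜 F] [SMulCommClass ℝ 𝕜 F]

@[simp]
theorem coe_toSchwartzMapLM (f : 𝓓_{K}(E, F)) : ⇑(toSchwartzMapLM 𝕜 f) = f := rfl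

theorem continuous_toSchwartzMapLM :
    Continuous (toSchwartzMapLM ℝ : 𝓓_{K}(E, F) →ₗ[ℝ] 𝓢(E, F)) := by
  refine WithSeminorms.continuous_of_isBounded
    (ContDiffMapSupportedIn.withSeminorms ℝ E F ⊤ K) (schwartz_withSeminorms ℝ E F) _
    (.of_real fun ⟨k, m⟩ ↦ ?_)
  obtain ⟨R, hR⟩ := K.isCompact.exists_bound_of_continuousOn (f := id) continuousOn_id
  refine ⟨{m}, |R| ^ k, fun f ↦ SchwartzMap.seminorm_le_bound ℝ k m _
    (mul_nonneg (by positivity) (apply_nonneg _ _)) fun x ↦ ?_⟩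
  by_cases hx : x ∈ K
  · simp only [Finset.sup_singleton, coe_toSchwartzMapLM]
    exact mul_le_mul (pow_le_pow_left₀ (norm_nonneg _) ((hR x hx).trans (le_abs_self R)) k)
      (norm_iteratedFDeriv_apply_le_seminorm_top ℝ) (norm_nonneg _) (by positivity)
  · rw [coe_toSchwartzMapLM, f.iteratedFDeriv_zero_on_compl hx]
    simpa using mul_nonneg (pow_nonneg (abs_nonneg R) k) (apply_nonneg _ _)

theorem isClosedEmbedding_toSchwartzMapLM :
    IsClosedEmbedding (toSchwartzMapLM ℝ : 𝓓_{K}(E, F) →ₗ[ℝ] 𝓢(E, F)) := by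
  set ι : 𝓓_{K}(E, F) →ₗ[ℝ] 𝓢(E, F) := toSchwartzMapLM ℝ
  refine ⟨⟨⟨le_antisymm continuous_toSchwartzMapLM.le_induced ?_⟩, fun f g h ↦ ?_⟩, ?_⟩
  -- The topology is no finer than the induced one: the weights `‖x‖ ^ 0` recover its seminorms.
  · rw [← continuous_id_iff_le]
    have h1 := ι.withSeminorms_induced (schwartz_withSeminorms ℝ E F)
    let _ := induced ι inferInstance
    refine WithSeminorms.continuous_of_isBounded h1
      (ContDiffMapSupportedIn.withSeminorms ℝ E F ⊤ K) LinearMap.id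
      (.of_real fun m ↦ ⟨{(0, m)}, 1, fun f ↦ ?_⟩)
    simp only [Finset.sup_singleton, one_mul]
    exact (ContDiffMapSupportedIn.seminorm_top_le_iff ℝ (apply_nonneg _ _) m f).2
      fun x _ ↦ SchwartzMap.norm_iteratedFDeriv_le_seminorm ℝ (ι f) m x
  · ext x
    exact DFunLike.congr_fun h x
  · have : Set.range ι = ⋂ x ∈ (K : Set E)ᶜ, {f : 𝓢(E, F) | f x = 0} := by
      ext f
      simp only [Set.mem_range, Set.mem_iInter, Set.mem_ofPred_eq]
      constructor
      · rintro ⟨g, rfl⟩ x hx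
        exact g.zero_on_compl hx
      · intro h
        exact ⟨⟨f, f.smooth ⊤, fun x hx ↦ h x hx⟩, rfl⟩
    rw [this]
    refine isClosed_biInter fun x _ ↦ isClosed_eq ?_ continuous_const
    exact (continuous_eval_const (F := BoundedContinuousFunction E F) x).comp
      (SchwartzMap.toBoundedContinuousFunctionCLM ℝ E F).continuous

instance [CompleteSpace F] : IsCompletelyPseudoMetrizableSpace 𝓓_{K}(E, F) :=
  isClosedEmbedding_toSchwartzMapLM.IsCompletelyPseudoMetrizableSpace

instance {𝕜 : Type*} [RCLike 𝕜] [NormedSpace 𝕜 F] [SMulCommClass ℝ 𝕜 F]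
    [FiniteDimensional ℝ E] [FiniteDimensional ℝ F] : MontelSpace 𝕜 𝓓_{K}(E, F) where
  heine_borel s hs hb := by
    have hι := isClosedEmbedding_toSchwartzMapLM (K := K) (E := E) (F := F)
    let ι : 𝓓_{K}(E, F) →L[𝕜] 𝓢(E, F) := ⟨toSchwartzMapLM 𝕜, hι.continuous⟩
    exact hι.isInducing.isCompact_iff.2 (MontelSpace.isCompact_of_isClosed_of_isVonNBounded 𝕜
      (hι.isClosedMap s hs) (hb.image ι))

end ContDiffMapSupportedIn

/-! ### Bounded sets of test functions -/

namespace TestFunction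
open scoped ContDiff Distributions BoundedContinuousFunction

variable {E F : Type*} [NormedAddCommGroup E] [NormedSpace ℝ E]
  [NormedAddCommGroup F] [NormedSpace ℝ F] [NormedSpace ℂ F]
  [IsScalarTower ℝ ℂ F] {Ω : Opens E}

/-- The map `f ↦ (c k • f (x k))` into the bounded sequences, for points `x k` that eventually leave
each compact set. It is continuous since only finitely many indices matter for functions supported
in a given compact set, so no condition on the weights `c k` is needed. -/
noncomputable def evalSequence (c : ℕ → ℂ) (x : ℕ → E)
    (hx : ∀ K : Set E, IsCompact K → ∃ N, ∀ k, N ≤ k → x k ∉ K) : 𝓓(Ω, F) →L[ℂ] ℕ →ᵇ F :=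
  have hbound : ∀ K : Compacts E, ∃ C : ℝ, 0 ≤ C ∧ ∀ (f : 𝓓_{K}(E, F)) (k : ℕ),
      ‖c k • f (x k)‖ ≤ C * ContDiffMapSupportedIn.seminorm ℂ E F ⊤ K 0 f := by
    intro K
    obtain ⟨N, hN⟩ := hx K K.isCompact
    refine ⟨∑ k ∈ Finset.range N, ‖c k‖, by positivity, fun f k ↦ ?_⟩
    rcases lt_or_ge k N with hk | hk
    · rw [norm_smul]
      exact mul_le_mul (Finset.single_le_sum (f := fun k ↦ ‖c k‖) (fun _ _ ↦ norm_nonneg _)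
        (Finset.mem_range.2 hk)) (ContDiffMapSupportedIn.norm_apply_le_seminorm ℂ)
        (norm_nonneg _) (by positivity)
    · rw [f.zero_on_compl (hN k hk)]
      simpa using mul_nonneg (Finset.sum_nonneg fun _ _ ↦ norm_nonneg _) (apply_nonneg _ _)
  have hbdd : ∀ f : 𝓓(Ω, F), ∃ C : ℝ, ∀ k, ‖c k • f (x k)‖ ≤ C := fun f ↦ by
    obtain ⟨C, -, hC⟩ := hbound ⟨tsupport f, f.hasCompactSupport⟩
    exact ⟨_, hC (.of_support_subset f.contDiff (subset_tsupport f))⟩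
  TestFunction.mkCLM ℂ
    (fun f ↦ BoundedContinuousFunction.ofNormedAddCommGroup (fun k ↦ c k • f (x k))
      continuous_of_discreteTopology _ (hbdd f).choose_spec)
    (fun f g ↦ by ext k; exact smul_add _ _ _)
    (fun a f ↦ by ext k; exact smul_comm _ _ _)
    (fun K hK ↦ by
      obtain ⟨C, hC0, hC⟩ := hbound K
      exact (ContDiffMapSupportedIn.mkCLMtoNormedSpace ℂ
        (fun f : 𝓓_{K}(E, F) ↦ BoundedContinuousFunction.ofNormedAddCommGroup
          (fun k ↦ c k • f (x k)) continuous_of_discreteTopology _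
          (hbdd (ofSupportedIn hK f)).choose_spec)
        (fun f g ↦ by ext k; exact smul_add _ _ _)
        (fun a f ↦ by ext k; exact smul_comm _ _ _)
        ⟨{0}, C, hC0, fun f ↦ by
          rw [Finset.sup_singleton]
          exact (BoundedContinuousFunction.norm_le (mul_nonneg hC0 (apply_nonneg _ _))).2
            (hC f)⟩).continuous)

@[simp]
theorem evalSequence_apply (c : ℕ → ℂ) (x : ℕ → E)
    (hx : ∀ K : Set E, IsCompact K → ∃ N, ∀ k, N ≤ k → x k ∉ K) (f : 𝓓(Ω, F)) (k : ℕ) :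
    evalSequence c x hx f k = c k • f (x k) := rfl

/-- The members of a bounded set of test functions are supported in one ball. Otherwise there are
members `f k` and points `x k` with `‖x k‖ > k` and `f k (x k) ≠ 0`, and the weighted evaluations
at the points `x k`, with weights `k / ‖f k (x k)‖`, are unbounded on the set. -/
theorem exists_forall_norm_le_of_isVonNBounded {B : Set 𝓓(Ω, F)}
    (hB : Bornology.IsVonNBounded ℂ B) : ∃ R : ℝ, ∀ f ∈ B, ∀ x, f x ≠ 0 → ‖x‖ ≤ R := by
  by_contra! h
  choose f hfB x hfx hx using fun k : ℕ ↦ h k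
  have hesc : ∀ K : Set E, IsCompact K → ∃ N, ∀ k, N ≤ k → x k ∉ K := by
    intro K hK
    obtain ⟨R, hR⟩ := hK.exists_bound_of_continuousOn (f := id) continuousOn_id
    obtain ⟨N, hN⟩ := exists_nat_ge R
    refine ⟨N, fun k hk hxk ↦ ?_⟩
    have h1 : ‖x k‖ ≤ R := hR _ hxk
    have h2 : (N : ℝ) ≤ k := by exact_mod_cast hk
    linarith [hx k]
  let L : 𝓓(Ω, F) →L[ℂ] ℕ →ᵇ F := evalSequence (fun k ↦ (((k : ℝ) / ‖f k (x k)‖ : ℝ) : ℂ)) x hesc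
  obtain ⟨M, hM⟩ := ((NormedSpace.isVonNBounded_iff ℂ).1 (hB.image L)).exists_norm_le
  obtain ⟨k, hk⟩ := exists_nat_gt M
  have h1 : ‖L (f k) k‖ ≤ M :=
    ((L (f k)).norm_coe_le_norm k).trans (hM _ (Set.mem_image_of_mem L (hfB k)))
  have h2 : ‖L (f k) k‖ = k := by
    simp only [L, evalSequence_apply, norm_smul, Complex.norm_real, norm_div, norm_norm,
      RCLike.norm_natCast]
    exact div_mul_cancel₀ _ (norm_ne_zero_iff.2 (hfx k))
  linarith

/-- A compatible family of continuous linear maps on the spaces of functions supported in a compact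
set extends to the inductive limit, so it is bounded on bounded sets of test functions. -/
theorem exists_forall_norm_lt_of_isVonNBounded {G : Type*} [NormedAddCommGroup G]
    [NormedSpace ℝ G] [NormedSpace ℂ G] [IsScalarTower ℝ ℂ G]
    (T : ∀ K : Compacts E, 𝓓_{K}(E, F) →L[ℂ] G)
    (hT : ∀ (K K' : Compacts E) (f : 𝓓_{K}(E, F)) (f' : 𝓓_{K'}(E, F)),
      (f : E → F) = f' → T K f = T K' f')
    {B : Set 𝓓(Ω, F)} (hB : Bornology.IsVonNBounded ℂ B) {K : Compacts E}
    (hK : (K : Set E) ⊆ Ω) :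
    ∃ M > 0, ∀ f : 𝓓_{K}(E, F), ofSupportedIn hK f ∈ B → ‖T K f‖ < M := by
  let L : 𝓓(Ω, F) →L[ℂ] G := TestFunction.limitCLM ℂ
    (fun f ↦ T ⟨tsupport f, f.hasCompactSupport⟩
      (.of_support_subset f.contDiff (subset_tsupport f)))
    (fun K _ ↦ T K) (fun _ _ _ ↦ hT _ _ _ _ rfl)
  obtain ⟨M, hM0, hM⟩ := ((NormedSpace.isVonNBounded_iff ℂ).1 (hB.image L)).exists_pos_norm_lt
  refine ⟨M, hM0, fun f hf ↦ ?_⟩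
  have h : L (ofSupportedIn hK f) = T K f := hT _ _ _ _ rfl
  exact h ▸ hM _ (Set.mem_image_of_mem L hf)

theorem isVonNBounded_preimage_ofSupportedIn {B : Set 𝓓(Ω, F)}
    (hB : Bornology.IsVonNBounded ℂ B) {K : Compacts E} (hK : (K : Set E) ⊆ Ω) :
    Bornology.IsVonNBounded ℂ (ofSupportedIn hK ⁻¹' B : Set 𝓓_{K}(E, F)) := by
  rw [(ContDiffMapSupportedIn.withSeminorms ℂ E F ⊤ K).isVonNBounded_iff_seminorm_bounded]
  intro i
  obtain ⟨M, hM0, hM⟩ := exists_forall_norm_lt_of_isVonNBounded (G := E →ᵇ (E [×i]→L[ℝ] F))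
    (fun K : Compacts E ↦ ContDiffMapSupportedIn.structureMapCLM (E := E) (F := F) (K := K) ℂ ⊤ i)
    (fun K K' f f' h ↦ by
      ext1 x
      rw [ContDiffMapSupportedIn.structureMapCLM_top_apply,
        ContDiffMapSupportedIn.structureMapCLM_top_apply, h]) hB hK
  exact ⟨M, hM0, fun f hf ↦ hM f hf⟩

end TestFunction

/-! ### The convergence principle -/

theorem DemiLinear.comp_linearMap {X X' Y : Type*} [AddCommGroup X] [Module ℂ X]
    [AddCommGroup X'] [Module ℂ X'] [AddCommGroup Y] [Module ℂ Y] {γ : ℂ → ℂ} {U : Set X}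
    {f : X → Y} (hf : f ∈ DemiLinear γ U) (L : X' →ₗ[ℂ] X) : f ∘ L ∈ DemiLinear γ (L ⁻¹' U) := by
  refine ⟨by simpa using hf.1, fun x u hu t ht ↦ ?_⟩
  simpa using hf.2 (L x) (L u) hu t ht

theorem pointwiseImpliesUniformOnBounded_of_montel {E Y : Type*}
    [AddCommGroup E] [Module ℂ E] [TopologicalSpace E] [IsTopologicalAddGroup E]
    [ContinuousSMul ℂ E] [T1Space E] [BaireSpace E] [MontelSpace ℂ E]
    [AddCommGroup Y] [Module ℂ Y] [TopologicalSpace Y] [IsTopologicalAddGroup Y]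
    [ContinuousSMul ℂ Y] {γ : ℂ → ℂ} (hγ : γ ∈ DemiLinearControl) {U : Set E} (hU : U ∈ 𝓝 0) :
    PointwiseImpliesUniformOnBounded (DemiLinear γ U : Set (E → Y)) :=
  pointwiseImpliesUniformOnBounded_demiLinear
    (fun _ hB ↦ MontelSpace.exists_isCompact_superset hB) hγ hU

theorem theorem1p2 (n : ℕ) (γ : ℂ → ℂ) (hγ : γ ∈ DemiLinearControl)
    {Y : Type*} [AddCommGroup Y] [Module ℂ Y] [TopologicalSpace Y]
    [IsTopologicalAddGroup Y] [ContinuousSMul ℂ Y] :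
    (∀ a : ℝ, 0 < a → ∀ U ∈ 𝓝 (0 : TestSpaceDBall n a),
      PointwiseImpliesUniformOnBounded
        (DemiLinear γ U : Set (TestSpaceDBall n a → Y))) ∧
    (∀ U ∈ 𝓝 (0 : TestSpaceD n),
      PointwiseImpliesUniformOnBounded
        (DemiLinear γ U : Set (TestSpaceD n → Y))) ∧
    (∀ U ∈ 𝓝 (0 : TestSpaceS n),
      PointwiseImpliesUniformOnBounded
        (DemiLinear γ U : Set (TestSpaceS n → Y))) := by
  have hball : ∀ a : ℝ, ∀ U ∈ 𝓝 (0 : TestSpaceDBall n a),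
      PointwiseImpliesUniformOnBounded (DemiLinear γ U : Set (TestSpaceDBall n a → Y)) :=
    fun a U hU ↦ pointwiseImpliesUniformOnBounded_of_montel hγ hU
  -- On `TestSpaceD` the bounded set lies in some `TestSpaceDBall`, to which all maps are restricted.
  refine ⟨fun a _ ↦ hball a, ?_, fun U hU ↦ pointwiseImpliesUniformOnBounded_of_montel hγ hU⟩
  intro U hU f fseq hf hfc hseq hc hlim B hB V hV
  obtain ⟨R, hR⟩ := TestFunction.exists_forall_norm_le_of_isVonNBounded hB
  have hRΩ : (euclideanClosedBall n R : Set (EuclideanSpace ℝ (Fin n))) ⊆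
      (⊤ : Opens (EuclideanSpace ℝ (Fin n))) := Set.subset_univ _
  let ι : TestSpaceDBall n R →L[ℂ] TestSpaceD n :=
    TestFunction.ofSupportedInCLM ℂ hRΩ
  have hU' : ι ⁻¹' U ∈ 𝓝 0 := ι.continuous.tendsto' 0 0 (map_zero ι) hU
  filter_upwards [hball R (ι ⁻¹' U) hU' (f ∘ ι) (fun ν ↦ fseq ν ∘ ι)
    (DemiLinear.comp_linearMap hf ι.toLinearMap) (hfc.comp ι.continuous)
    (fun ν ↦ DemiLinear.comp_linearMap (hseq ν) ι.toLinearMap) (fun ν ↦ (hc ν).comp ι.continuous)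
    (fun ξ ↦ hlim (ι ξ)) (ι ⁻¹' B)
    (TestFunction.isVonNBounded_preimage_ofSupportedIn hB hRΩ) V hV] with ν hν φ hφ
  exact hν ⟨φ, φ.contDiff, fun x hx ↦ by
    by_contra h
    exact hx (mem_closedBall_zero_iff.2 (hR φ hφ x h))⟩ hφ
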